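/- \textbf{Setting.} For each $n\ge 1$ consider the model $y_{ih}=z_{ih}^{T}\eta^{0}+x_{ih}^{T}\beta_i^{0}+\epsilon_{ih}$, $i=1,\dots,n$, $h=1,\dots,n_i$, where $n_i\ge 1$, the covariates $z_{ih}\in\mathbb R^{q}$ and $x_{ih}\in\mathbb R^{p}$ are deterministic, $\{1,\dots,n\}$ is partitioned into $K$ non-empty groups $\mathcal G_1,\dots,\mathcal G_K$, and $\beta_i^{0}=\alpha_k^{0}$ for $i\in\mathcal G_k$. The errors $\epsilon_{ih}$ are i.i.d. with mean $0$ and variance $\sigma^2$, where $\sigma>0$ does not depend on $n$. All of $q,p,K,n_i,\mathcal G_k,z_{ih},x_{ih},\eta^0,\alpha^0$ and the error law may depend on $n$. Write $|\mathcal G_{\min}|$ and $|\mathcal G_{\max}|$ for the smallest and largest group sizes. Let $y$ and $\epsilon$ be the stacked responses and errors, $Z$ the matrix with rows $z_{ih}^T$, $X=\mathrm{diag}(X_1,\dots,X_n)$ with $X_i$ having rows $x_{ih}^T$, $W=\widetilde W\otimes I_p$ with $\widetilde W_{ik}=1\{i\in\mathcal G_k\}$, $U=(Z,XW)$ and $\Omega=\mathrm{diag}(n_1^{-1}I_{n_1},\dots,n_n^{-1}I_{n_n})$.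 The oracle weighted least squares estimator is \[(\hat\eta^{or},\hat\alpha^{or})=\arg\min_{\eta,\alpha}\tfrac12\|\Omega^{1/2}(y-Z\eta-XW\alpha)\|^2=(U^T\Omega U)^{-1}U^T\Omega y,\qquad \hat\beta^{or}=W\hat\alpha^{or},\] and $\beta^0=W\alpha^0$; $\|\cdot\|$ is the Euclidean norm. \textbf{Theorem.} Suppose there are an $N\ge1$ and constants $M_1,M_2,M_3,C_1,C_1',C_2,C_3,c_1\in(0,\infty)$, not depending on $n$, such that for all $n\ge N$: (i) $|x_{ih,l}|\le M_1$ and $|z_{ih,l}|\le M_1$ for all $i,h,l$; $M_2\le\max_i n_i/\min_i n_i\le M_3$; every eigenvalue of $U^T\Omega U$ lies between $C_1|\mathcal G_{\min}|$ and $C_1'n$; $\|x_{ih}\|\le C_2\sqrt p$ and $\|z_{ih}\|\le C_3\sqrt q$ for all $i,h$; (ii) $P(|a^T\epsilon|>\|a\|t)\le 2\exp(-c_1t^2)$ for every deterministic vector $a\in\mathbb R^{n_1+\dots+n_n}$ and every $t>0$. Suppose moreover that, as $n\to\infty$, $q/n\to0$, $Kp/n\to0$ and \[\frac{(q+Kp)^{1/2}}{|\mathcal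 G_{\min}|}\max\Big(\sqrt{\tfrac{n}{\min_i n_i}\log n},\ (q+Kp)^{1/2}\Big)\to0 .\] Let $\phi_n=c_1^{-1/2}C_1^{-1}M_1\sqrt{q+Kp}\,|\mathcal G_{\min}|^{-1}\sqrt{\frac{n}{\min_i n_i}\log n}$. Then for every $n\ge N$, with probability at least $1-2(q+Kp)/n$, the following bounds hold simultaneously: \[\left\|\begin{pmatrix}\hat\eta^{or}-\eta^0\\ \hat\alpha^{or}-\alpha^0\end{pmatrix}\right\|\le\phi_n,\qquad \|\hat\beta^{or}-\beta^0\|\le\sqrt{|\mathcal G_{\max}|}\,\phi_n,\qquad \sup_i\|\hat\beta^{or}_i-\beta^0_i\|\le\phi_n .\] Furthermore, for every sequence of deterministic vectors $a_n\in\mathbb R^{q+Kp}$ that are non-zero for all large $n$, \[\sigma_n(a_n)^{-1}a_n^T\big((\hat\eta^{or}-\eta^0)^T,(\hat\alpha^{or}-\alpha^0)^T\big)^T\ \xrightarrow{d}\ N(0,1)\quad\text{as } n\to\infty,\] where $\sigma_n(a_n)=\sigma\,[a_n^T(U^T\Omega U)^{-1}U^T\Omega\Omega U(U^T\Omega U)^{-1}a_n]^{1/2}$.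 -/

import Mathlib

open MeasureTheory ProbabilityTheory Filter Topology
open scoped Matrix Kronecker

noncomputable section

namespace SaSa

/-- The deterministic part of the repeated measures model with `n` locations: `q` global and `p`
local covariates, `reps i ≥ 1` measurements at location `i`, covariate vectors `z i h` and `x i h`,
and a partition of the locations into `K` nonempty groups, location `i` lying in group `group i`. -/
structure Design (n : ℕ) where
  q : ℕ
  p : ℕ
  K : ℕ
  reps : Fin n → ℕ
  reps_pos : ∀ i, 0 < reps i
  group : Fin n → Fin K
  group_surj : Function.Surjective group
  z : (i : Fin n) → Fin (reps i) → EuclideanSpace ℝ (Fin q)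
  x : (i : Fin n) → Fin (reps i) → EuclideanSpace ℝ (Fin p)

namespace Design

variable {n : ℕ} (D : Design n)

/-- The observations `(i, h)`, `h` being one of the `reps i` measurements at location `i`. -/
abbrev Obs : Type := (i : Fin n) × Fin (D.reps i)

/-- Indices of the entries of `(η, α) ∈ ℝ^(q + K p)`. -/
abbrev Idx : Type := Fin D.q ⊕ (Fin D.K × Fin D.p)

/-- The matrix with rows `z i h`. -/
def Z : Matrix D.Obs (Fin D.q) ℝ := Matrix.of fun o l => D.z o.1 o.2 l

/-- The block diagonal matrix `diag(X₁, …, Xₙ)`, the rows of `Xᵢ` being the `x i h`. -/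
def X : Matrix D.Obs (Fin n × Fin D.p) ℝ :=
  Matrix.of fun o j => if o.1 = j.1 then D.x o.1 o.2 j.2 else 0

/-- The group membership matrix. -/
def Wtilde : Matrix (Fin n) (Fin D.K) ℝ :=
  Matrix.of fun i k => if D.group i = k then 1 else 0

def W : Matrix (Fin n × Fin D.p) (Fin D.K × Fin D.p) ℝ :=
  D.Wtilde ⊗ₖ (1 : Matrix (Fin D.p) (Fin D.p) ℝ)

/-- `U = (Z, X W)`. -/
def U : Matrix D.Obs D.Idx ℝ := Matrix.fromCols D.Z (D.X * D.W)

/-- The weight matrix: observation `(i, h)` has weight `1 / reps i`. -/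
def Omega : Matrix D.Obs D.Obs ℝ := Matrix.diagonal fun o => 1 / (D.reps o.1 : ℝ)

/-- `Uᵀ Ω U`. -/
def gram : Matrix D.Idx D.Idx ℝ := D.Uᵀ * D.Omega * D.U

theorem gram_isHermitian : D.gram.IsHermitian := by
  simp [Matrix.IsHermitian, gram, Omega, Matrix.conjTranspose_eq_transpose_of_trivial,
    Matrix.transpose_mul, Matrix.mul_assoc]

def groupSize (k : Fin D.K) : ℕ := (Finset.univ.filter fun i => D.group i = k).card

/-- The smallest group size. -/
def Gmin : ℕ := ⨅ k, D.groupSize k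

/-- The largest group size. -/
def Gmax : ℕ := ⨆ k, D.groupSize k

def minReps : ℕ := ⨅ i, D.reps i

def maxReps : ℕ := ⨆ i, D.reps i

/-- The vector `β = W α` of location-specific coefficients with group coefficients `α`. -/
def beta (α : EuclideanSpace ℝ (Fin D.K × Fin D.p)) : EuclideanSpace ℝ (Fin n × Fin D.p) :=
  WithLp.toLp 2 (D.W *ᵥ α.ofLp)

/-- The block `β_i ∈ ℝ^p` of `β ∈ ℝ^(n p)`. -/
def block (β : EuclideanSpace ℝ (Fin n × Fin D.p)) (i : Fin n) : EuclideanSpace ℝ (Fin D.p) :=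
  WithLp.toLp 2 fun l => β (i, l)

/-- The stacked vector `(η, α)`. -/
def stack (η : EuclideanSpace ℝ (Fin D.q)) (α : EuclideanSpace ℝ (Fin D.K × Fin D.p)) :
    EuclideanSpace ℝ D.Idx := WithLp.toLp 2 (Sum.elim η.ofLp α.ofLp)

/-- The component `α` of `(η, α)`. -/
def alphaPart (θ : EuclideanSpace ℝ D.Idx) : EuclideanSpace ℝ (Fin D.K × Fin D.p) :=
  WithLp.toLp 2 fun j => θ (Sum.inr j)

/-- The responses `y_ih = z_ihᵀ η + x_ihᵀ β_i + ε_ih`. -/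
def response (η : EuclideanSpace ℝ (Fin D.q)) (β : EuclideanSpace ℝ (Fin n × Fin D.p))
    (ε : D.Obs → ℝ) : D.Obs → ℝ :=
  fun o => (∑ l, D.z o.1 o.2 l * η l) + (∑ l, D.x o.1 o.2 l * D.block β o.1 l) + ε o

/-- The weighted least squares criterion `½ ‖Ω^(1/2) (y - Z η - X W α)‖²` at `θ = (η, α)`. -/
def wls (y : D.Obs → ℝ) (θ : EuclideanSpace ℝ D.Idx) : ℝ :=
  1 / 2 * ∑ o : D.Obs, 1 / (D.reps o.1 : ℝ) * (y o - (D.U *ᵥ θ.ofLp) o) ^ 2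

/-- The oracle estimator `(η̂, α̂) = (Uᵀ Ω U)⁻¹ Uᵀ Ω y`; see `wls_oracle_lt`. -/
def oracle (y : D.Obs → ℝ) : EuclideanSpace ℝ D.Idx :=
  WithLp.toLp 2 ((D.gram⁻¹ * D.Uᵀ * D.Omega) *ᵥ y)

/-- The oracle estimator computed from the responses with true coefficients `η`, `α` and
errors `ε`. -/
def estimate (η : EuclideanSpace ℝ (Fin D.q)) (α : EuclideanSpace ℝ (Fin D.K × Fin D.p))
    (ε : D.Obs → ℝ) : EuclideanSpace ℝ D.Idx :=
  D.oracle (D.response η (D.beta α) ε)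

theorem wls_eq (y : D.Obs → ℝ) (θ : EuclideanSpace ℝ D.Idx) :
    D.wls y θ = 1 / 2 * ((y - D.U *ᵥ θ.ofLp) ⬝ᵥ (D.Omega *ᵥ (y - D.U *ᵥ θ.ofLp))) := by
  simp only [wls, Omega, Matrix.mulVec_diagonal, dotProduct, Pi.sub_apply]
  congr 1
  exact Finset.sum_congr rfl fun o _ => by ring

/-- The oracle estimator is the unique minimizer of the weighted least squares criterion as soon
as all eigenvalues of `Uᵀ Ω U` are positive. -/
theorem wls_oracle_lt (h : ∀ j, 0 < D.gram_isHermitian.eigenvalues j) (y : D.Obs → ℝ)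
    (θ : EuclideanSpace ℝ D.Idx) (hθ : θ ≠ D.oracle y) : D.wls y (D.oracle y) < D.wls y θ := by
  have hpd : D.gram.PosDef := D.gram_isHermitian.posDef_iff_eigenvalues_pos.2 h
  have hdet : IsUnit D.gram.det := hpd.det_pos.ne'.isUnit
  set t := (D.oracle y).ofLp with ht
  set d : D.Idx → ℝ := θ.ofLp - t with hd
  have hd0 : d ≠ 0 := by
    intro h0
    apply hθ
    exact WithLp.ofLp_injective 2 (sub_eq_zero.1 h0)
  have hnormal : D.Uᵀ *ᵥ (D.Omega *ᵥ (y - D.U *ᵥ t)) = 0 := by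
    have h1 : D.gram *ᵥ t = (D.Uᵀ * D.Omega) *ᵥ y := by
      rw [ht, oracle, Matrix.mulVec_mulVec, Matrix.mul_assoc, Matrix.mul_nonsing_inv_cancel_left _ _ hdet]
    rw [Matrix.mulVec_sub, Matrix.mulVec_sub, Matrix.mulVec_mulVec, Matrix.mulVec_mulVec,
      Matrix.mulVec_mulVec, ← h1, gram, sub_self]
  have hq : 0 < d ⬝ᵥ (D.gram *ᵥ d) := by
    have := hpd.dotProduct_mulVec_pos hd0
    simpa using this
  have hsplit : y - D.U *ᵥ θ.ofLp = (y - D.U *ᵥ t) - D.U *ᵥ d := by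
    rw [hd, Matrix.mulVec_sub]; abel
  have hOm : D.Omegaᵀ = D.Omega := by simp [Omega]
  set r := y - D.U *ᵥ t with hr
  have hc1 : (D.U *ᵥ d) ⬝ᵥ (D.Omega *ᵥ r) = 0 := by
    rw [dotProduct_comm, Matrix.dotProduct_mulVec, ← Matrix.mulVec_transpose, hnormal,
      zero_dotProduct]
  have hc2 : r ⬝ᵥ (D.Omega *ᵥ (D.U *ᵥ d)) = 0 := by
    rw [Matrix.dotProduct_mulVec, ← Matrix.mulVec_transpose, hOm, dotProduct_comm, hc1]
  have hc3 : (D.U *ᵥ d) ⬝ᵥ (D.Omega *ᵥ (D.U *ᵥ d)) = d ⬝ᵥ (D.gram *ᵥ d) := by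
    rw [gram, ← Matrix.mulVec_mulVec, ← Matrix.mulVec_mulVec,
      Matrix.dotProduct_mulVec d, Matrix.vecMul_transpose]
  have hexp : (r - D.U *ᵥ d) ⬝ᵥ (D.Omega *ᵥ (r - D.U *ᵥ d)) =
      r ⬝ᵥ (D.Omega *ᵥ r) + d ⬝ᵥ (D.gram *ᵥ d) := by
    rw [Matrix.mulVec_sub D.Omega, sub_dotProduct, dotProduct_sub, dotProduct_sub, hc1, hc2, hc3]
    ring
  rw [wls_eq, wls_eq, hsplit, hexp, ← ht, ← hr]
  linarith

/-- Bounds on the covariates, the numbers of measurements and the eigenvalues of `Uᵀ Ω U`. -/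
structure DesignBounds (M₁ M₂ M₃ C₁ C₁' C₂ C₃ : ℝ) : Prop where
  abs_x_le : ∀ i h l, |D.x i h l| ≤ M₁
  abs_z_le : ∀ i h l, |D.z i h l| ≤ M₁
  le_ratio : M₂ ≤ (D.maxReps : ℝ) / D.minReps
  ratio_le : (D.maxReps : ℝ) / D.minReps ≤ M₃
  le_eigenvalues : ∀ j, C₁ * D.Gmin ≤ D.gram_isHermitian.eigenvalues j
  eigenvalues_le : ∀ j, D.gram_isHermitian.eigenvalues j ≤ C₁' * n
  norm_x_le : ∀ i h, ‖D.x i h‖ ≤ C₂ * √(D.p : ℝ)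
  norm_z_le : ∀ i h, ‖D.z i h‖ ≤ C₃ * √(D.q : ℝ)

/-- I.i.d. errors with mean `0`, variance `σ²` and sub-Gaussian tails with constant `c₁`. -/
structure IsSubGaussianNoise {Ω : Type*} [MeasurableSpace Ω] (μ : Measure Ω)
    (ε : D.Obs → Ω → ℝ) (σ c₁ : ℝ) : Prop where
  indep : iIndepFun ε μ
  identDistrib : ∀ o o', IdentDistrib (ε o) (ε o') μ μ
  memLp : ∀ o, MemLp (ε o) 2 μ
  mean : ∀ o, ∫ ω, ε o ω ∂μ = 0
  variance : ∀ o, Var[ε o; μ] = σ ^ 2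
  tail : ∀ (a : EuclideanSpace ℝ D.Obs) (t : ℝ), 0 < t →
    μ.real {ω | ‖a‖ * t < |∑ o, a o * ε o ω|} ≤ 2 * Real.exp (-c₁ * t ^ 2)

/-- `φ_n = c₁^(-1/2) C₁⁻¹ M₁ (q + K p)^(1/2) |G_min|⁻¹ ((n / min n_i) log n)^(1/2)`. -/
def phi (M₁ C₁ c₁ : ℝ) : ℝ :=
  (√c₁)⁻¹ * C₁⁻¹ * M₁ * √((D.q : ℝ) + D.K * D.p) * (D.Gmin : ℝ)⁻¹ *
    √((n : ℝ) / D.minReps * Real.log n)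

/-- `σ_n(a) = σ [aᵀ (UᵀΩU)⁻¹ UᵀΩΩU (UᵀΩU)⁻¹ a]^(1/2)`. -/
def sigmaN (σ : ℝ) (a : EuclideanSpace ℝ D.Idx) : ℝ :=
  σ * √(a.ofLp ⬝ᵥ ((D.gram⁻¹ * (D.Uᵀ * D.Omega * D.Omega * D.U) * D.gram⁻¹) *ᵥ a.ofLp))

end Design

end SaSa

end

/-! Write G = UᵀΩU. Its eigenvalues are at least C₁|G_min| > 0, so the estimation error equals
G⁻¹UᵀΩε, which is linear in the noise.

Error bounds. Each coordinate of UᵀΩε pairs ε with a column of ΩU, whose norm is at most M₁√(n / min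
n_i) (`DesignBounds.norm_weightedCol_le`). At level √(log n / c₁) the tail bound fails with
probability at most 2/n per column, hence at most 2(q+Kp)/n overall. Otherwise UᵀΩε has norm at most
√(q+Kp) times the coordinate bound, and dividing by the least eigenvalue of G gives exactly φ_n
(`DesignBounds.norm_estimate_sub_stack_le`).

Normality. Here aᵀ(θ̂ - θ) = vᵀε with v = ΩUG⁻¹a, and σ_n(a) = σ‖v‖. The tails bound the third
moments of the errors uniformly in n, even if their law changes, so Lyapunov's theorem only needs
max |v_o| / ‖v‖ → 0. With b = G⁻¹a, Cauchy-Schwarz bounds v_o² by a multiple of (q+Kp)‖b‖², while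
the eigenvalue bound gives ‖v‖² ≥ C₁|G_min|‖b‖² / max n_i. The unknown b cancels, leaving
O((q+Kp)/|G_min|) (`DesignBounds.functionalWeight_sq_le`). -/

/-! ### Lyapunov's theorem by characteristic functions -/

open Complex in
/-- Third order Taylor bound for the complex exponential on the imaginary axis. -/
theorem norm_exp_mul_I_sub_taylor_le (x : ℝ) :
    ‖cexp (x * I) - (1 + x * I - (x : ℂ) ^ 2 / 2)‖ ≤ 4 * |x| ^ 3 := by
  rcases le_or_gt |x| 1 with h | h
  · have h1 : ‖(x * I : ℂ)‖ = |x| := by simp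
    have := Complex.exp_bound (x := x * I) (by rw [h1]; exact h) (n := 3) (by norm_num)
    rw [h1] at this
    have hs : ∑ m ∈ Finset.range 3, (x * I : ℂ) ^ m / (m.factorial : ℂ) =
        1 + x * I - (x : ℂ) ^ 2 / 2 := by
      simp [Finset.sum_range_succ, Nat.factorial, mul_pow]
      ring
    rw [hs] at this
    refine this.trans ?_
    rw [mul_comm]
    gcongr
    norm_num [Nat.factorial]
  -- For |x| > 1 the triangle inequality suffices: 2 + |x| + x²/2 is at most 4|x|³. This case
  -- dictates the constant 4.
  · have h2 : ‖(1 + x * I - (x : ℂ) ^ 2 / 2 : ℂ)‖ ≤ 1 + |x| + |x| ^ 2 / 2 := by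
      refine (norm_sub_le _ _).trans (add_le_add ((norm_add_le _ _).trans ?_) ?_) <;> simp
    have h3 : ‖cexp (x * I)‖ = 1 := Complex.norm_exp_ofReal_mul_I x
    have h4 := norm_sub_le (cexp (x * I)) (1 + x * I - (x : ℂ) ^ 2 / 2)
    have h5 : |x| ≤ |x| ^ 3 := le_self_pow₀ h.le (by norm_num)
    have h6 : |x| ^ 2 ≤ |x| ^ 3 := pow_le_pow_right₀ h.le (by norm_num)
    linarith

/-- Telescoping: the factors are exchanged one at a time, and the remaining ones have modulus at
most 1. -/
theorem norm_prod_sub_prod_le_sum {ι : Type*} (s : Finset ι) (f g : ι → ℂ)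
    (hf : ∀ i ∈ s, ‖f i‖ ≤ 1) (hg : ∀ i ∈ s, ‖g i‖ ≤ 1) :
    ‖∏ i ∈ s, f i - ∏ i ∈ s, g i‖ ≤ ∑ i ∈ s, ‖f i - g i‖ := by
  classical
  induction s using Finset.induction_on with
  | empty => simp
  | insert i s hi ih =>
    rw [Finset.prod_insert hi, Finset.prod_insert hi, Finset.sum_insert hi]
    have h1 : f i * ∏ j ∈ s, f j - g i * ∏ j ∈ s, g j =
        (f i - g i) * ∏ j ∈ s, f j + g i * (∏ j ∈ s, f j - ∏ j ∈ s, g j) := by ring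
    rw [h1]
    have h2 : ‖∏ j ∈ s, f j‖ ≤ 1 := by
      rw [norm_prod]
      exact Finset.prod_le_one (fun _ _ => norm_nonneg _)
        fun j hj => hf j (Finset.mem_insert_of_mem hj)
    refine (norm_add_le _ _).trans (add_le_add ?_ ?_)
    · rw [norm_mul]
      exact mul_le_of_le_one_right (norm_nonneg _) h2
    · rw [norm_mul]
      exact (mul_le_of_le_one_left (norm_nonneg _) (hg i (Finset.mem_insert_self _ _))).trans
        (ih (fun j hj => hf j (Finset.mem_insert_of_mem hj))
          fun j hj => hg j (Finset.mem_insert_of_mem hj))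

/-- Used with u = (wt)²v/2 to pass from the quadratic expansion of a characteristic function to the
Gaussian factor. -/
theorem abs_exp_neg_sub_one_sub_le_sq {u : ℝ} (hu : 0 ≤ u) :
    |Real.exp (-u) - (1 - u)| ≤ u ^ 2 := by
  rcases le_or_gt u 1 with h | h
  · have := Real.abs_exp_sub_one_sub_id_le (x := -u) (by rw [abs_neg, abs_of_nonneg hu]; exact h)
    rw [neg_sq] at this
    convert this using 2
    ring
  · have h1 : Real.exp (-u) ≤ 1 := Real.exp_le_one_iff.2 (by linarith)
    have h2 := Real.exp_pos (-u)
    rw [abs_le]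
    constructor <;> nlinarith

/-- Second order expansion of the characteristic function of a centered random variable, with the
error controlled by its third absolute moment. -/
theorem norm_charFun_sub_le {Ω : Type*} [MeasurableSpace Ω] {μ : Measure Ω}
    [IsProbabilityMeasure μ] {Y : Ω → ℝ} (hY : AEMeasurable Y μ) {v B : ℝ}
    (h1 : Integrable Y μ) (h2 : Integrable (fun ω => Y ω ^ 2) μ)
    (h3 : Integrable (fun ω => |Y ω| ^ 3) μ) (hmean : ∫ ω, Y ω ∂μ = 0)
    (hvar : ∫ ω, Y ω ^ 2 ∂μ = v) (hB : ∫ ω, |Y ω| ^ 3 ∂μ ≤ B) (s : ℝ) :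
    ‖charFun (μ.map Y) s - ((1 - s ^ 2 * v / 2 : ℝ) : ℂ)‖ ≤ 4 * B * |s| ^ 3 := by
  have hc : charFun (μ.map Y) s = ∫ ω, Complex.exp ((s * Y ω : ℝ) * Complex.I) ∂μ := by
    rw [charFun_apply_real, integral_map hY (by fun_prop)]
    simp
  have hi0 : Integrable (fun ω => Complex.exp ((s * Y ω : ℝ) * Complex.I)) μ := by
    refine Integrable.of_bound (C := 1) ?_ (ae_of_all _ fun ω => ?_)
    · exact (by fun_prop : AEMeasurable (fun ω => Complex.exp ((s * Y ω : ℝ) * Complex.I)) μ)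
        |>.aestronglyMeasurable
    · rw [Complex.norm_exp_ofReal_mul_I]
  have hi1 : Integrable (fun ω => ((s * Y ω : ℝ) : ℂ) * Complex.I) μ :=
    ((h1.const_mul s).ofReal (𝕜 := ℂ)).mul_const _
  have hi2 : Integrable (fun ω => ((s * Y ω : ℝ) : ℂ) ^ 2 / 2) μ := by
    have := ((h2.const_mul (s ^ 2)).ofReal (𝕜 := ℂ)).div_const 2
    refine this.congr (ae_of_all _ fun ω => ?_)
    simp [mul_pow]
  have hi01 : Integrable (fun ω => (1 : ℂ) + ((s * Y ω : ℝ) : ℂ) * Complex.I) μ :=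
    (integrable_const _).add hi1
  have hi012 : Integrable (fun ω => (1 : ℂ) + ((s * Y ω : ℝ) : ℂ) * Complex.I -
      ((s * Y ω : ℝ) : ℂ) ^ 2 / 2) μ := hi01.sub hi2
  have hT : ∫ ω, (1 + ((s * Y ω : ℝ) : ℂ) * Complex.I - ((s * Y ω : ℝ) : ℂ) ^ 2 / 2) ∂μ =
      ((1 - s ^ 2 * v / 2 : ℝ) : ℂ) := by
    rw [integral_sub hi01 hi2, integral_add (integrable_const _) hi1,
      integral_mul_const, integral_div]
    have e1 : ∫ ω, ((s * Y ω : ℝ) : ℂ) ∂μ = 0 := by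
      rw [integral_complex_ofReal, integral_const_mul, hmean]; simp
    have e2 : ∫ ω, ((s * Y ω : ℝ) : ℂ) ^ 2 ∂μ = (s ^ 2 * v : ℝ) := by
      rw [← hvar, ← integral_const_mul, ← integral_complex_ofReal]
      simp [mul_pow]
    rw [e1, e2]
    simp
  rw [hc, ← hT, ← integral_sub hi0 hi012]
  calc _ ≤ ∫ ω, 4 * |s| ^ 3 * |Y ω| ^ 3 ∂μ := by
        refine norm_integral_le_of_norm_le (h3.const_mul _) (ae_of_all _ fun ω => ?_)
        refine (norm_exp_mul_I_sub_taylor_le _).trans_eq ?_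
        rw [abs_mul, mul_pow, mul_assoc]
    _ = 4 * |s| ^ 3 * ∫ ω, |Y ω| ^ 3 ∂μ := integral_const_mul _ _
    _ ≤ 4 * |s| ^ 3 * B := by gcongr
    _ = _ := by ring

/-- **Lyapunov's central limit theorem** for weighted sums of row-wise independent centered random
variables with variance `v` and uniformly bounded third moments. -/
theorem tendstoInDistribution_sum_of_third_moment_le {ι : ℕ → Type*} [∀ n, Fintype (ι n)]
    {Ω : ℕ → Type*} [∀ n, MeasurableSpace (Ω n)] {μ : (n : ℕ) → Measure (Ω n)}
    [∀ n, IsProbabilityMeasure (μ n)] {Y : (n : ℕ) → ι n → Ω n → ℝ} {w : (n : ℕ) → ι n → ℝ}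
    {v B : ℝ} {δ : ℕ → ℝ} (hv : 0 < v) (hY : ∀ n i, Measurable (Y n i))
    (hindep : ∀ᶠ n in atTop, iIndepFun (Y n) (μ n))
    (h1 : ∀ᶠ n in atTop, ∀ i, Integrable (Y n i) (μ n))
    (h2 : ∀ᶠ n in atTop, ∀ i, Integrable (fun ω => Y n i ω ^ 2) (μ n))
    (h3 : ∀ᶠ n in atTop, ∀ i, Integrable (fun ω => |Y n i ω| ^ 3) (μ n))
    (hmean : ∀ᶠ n in atTop, ∀ i, ∫ ω, Y n i ω ∂μ n = 0)
    (hvar : ∀ᶠ n in atTop, ∀ i, ∫ ω, Y n i ω ^ 2 ∂μ n = v)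
    (hB : ∀ᶠ n in atTop, ∀ i, ∫ ω, |Y n i ω| ^ 3 ∂μ n ≤ B)
    (hw : ∀ᶠ n in atTop, ∑ i, w n i ^ 2 = v⁻¹)
    (hwδ : ∀ᶠ n in atTop, ∀ i, |w n i| ≤ δ n) (hδ : Tendsto δ atTop (𝓝 0)) :
    TendstoInDistribution (fun n ω => ∑ i, w n i * Y n i ω) atTop (id : ℝ → ℝ) μ
      (gaussianReal 0 1) where
  forall_aemeasurable n :=
    (Finset.measurable_fun_sum _ fun i _ => (hY n i).const_mul _).aemeasurable
  tendsto := by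
    refine ProbabilityMeasure.tendsto_iff_tendsto_charFun.2 fun t => ?_
    simp only [ProbabilityMeasure.coe_mk, Measure.map_id, charFun_gaussianReal]
    have hlim : Tendsto (fun n => 4 * B * |t| ^ 3 * v⁻¹ * δ n +
        t ^ 4 * v ^ 2 / 4 * v⁻¹ * δ n ^ 2) atTop (𝓝 0) := by
      simpa using (hδ.const_mul (4 * B * |t| ^ 3 * v⁻¹)).add
        ((hδ.pow 2).const_mul (t ^ 4 * v ^ 2 / 4 * v⁻¹))
    rw [tendsto_iff_norm_sub_tendsto_zero]
    refine tendsto_of_tendsto_of_tendsto_of_le_of_le' tendsto_const_nhds hlim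
      (Eventually.of_forall fun _ => norm_nonneg _) ?_
    filter_upwards [hindep, h1, h2, h3, hmean, hvar, hB, hw, hwδ] with n hindep h1 h2 h3 hmean hvar
      hB hw hwδ
    have hprod : charFun ((μ n).map fun ω => ∑ i, w n i * Y n i ω) t =
        ∏ i, charFun ((μ n).map (Y n i)) (w n i * t) := by
      have hind : iIndepFun (fun i ω => w n i * Y n i ω) (μ n) :=
        hindep.comp (fun i x => w n i * x) fun i => by fun_prop
      rw [hind.charFun_map_fun_sum_eq_prod fun i => ((hY n i).const_mul _).aemeasurable]
      rw [Finset.prod_apply]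
      exact Finset.prod_congr rfl fun i _ => charFun_map_mul_comp (hY n i).aemeasurable _ _
    -- Since the squared weights sum to 1/v, the standard Gaussian characteristic function splits
    -- into one factor per summand.
    have hgauss : Complex.exp ((t : ℂ) * ((0 : ℝ) : ℂ) * Complex.I -
        (((1 : NNReal) : ℝ) : ℂ) * (t : ℂ) ^ 2 / 2) =
        ∏ i, ((Real.exp (-((w n i * t) ^ 2 * v / 2)) : ℝ) : ℂ) := by
      rw [← Complex.ofReal_prod, ← Real.exp_sum, Finset.sum_neg_distrib]
      have : ∑ i, (w n i * t) ^ 2 * v / 2 = t ^ 2 / 2 := by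
        have e : ∀ i, (w n i * t) ^ 2 * v / 2 = w n i ^ 2 * (t ^ 2 * v / 2) := fun i => by ring
        simp_rw [e]
        rw [← Finset.sum_mul, hw]
        field_simp
      rw [this, Complex.ofReal_exp]
      congr 1
      push_cast
      ring
    rw [hprod, hgauss]
    refine (norm_prod_sub_prod_le_sum _ _ _ (fun i _ => ?_) fun i _ => ?_).trans ?_
    · have := Measure.isProbabilityMeasure_map (μ := μ n) (hY n i).aemeasurable
      exact norm_charFun_le_one _
    · rw [Complex.norm_real, Real.norm_of_nonneg (Real.exp_pos _).le]
      exact Real.exp_le_one_iff.2 (by have := sq_nonneg (w n i * t); nlinarith)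
    -- Keeping w² as a factor and bounding the other powers of |w| by δ makes the sum over i equal
    -- to 1/v times a quantity tending to 0.
    · have hterm : ∀ i, ‖charFun ((μ n).map (Y n i)) (w n i * t) -
          ((Real.exp (-((w n i * t) ^ 2 * v / 2)) : ℝ) : ℂ)‖ ≤
          w n i ^ 2 * (4 * B * |t| ^ 3 * δ n + t ^ 4 * v ^ 2 / 4 * δ n ^ 2) := by
        intro i
        have hB0 : 0 ≤ B := (integral_nonneg fun ω => by positivity).trans (hB i)
        have e1 := norm_charFun_sub_le (hY n i).aemeasurable (h1 i) (h2 i) (h3 i) (hmean i)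
          (hvar i) (hB i) (w n i * t)
        have e2 : ‖((1 - (w n i * t) ^ 2 * v / 2 : ℝ) : ℂ) -
            ((Real.exp (-((w n i * t) ^ 2 * v / 2)) : ℝ) : ℂ)‖ ≤ ((w n i * t) ^ 2 * v / 2) ^ 2 := by
          rw [← Complex.ofReal_sub, Complex.norm_real, Real.norm_eq_abs, abs_sub_comm]
          exact abs_exp_neg_sub_one_sub_le_sq (by positivity)
        have e3 := norm_sub_le_norm_sub_add_norm_sub (charFun ((μ n).map (Y n i)) (w n i * t))
          ((1 - (w n i * t) ^ 2 * v / 2 : ℝ) : ℂ)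
          ((Real.exp (-((w n i * t) ^ 2 * v / 2)) : ℝ) : ℂ)
        refine (e3.trans (add_le_add e1 e2)).trans ?_
        have f1 : 4 * B * |w n i * t| ^ 3 ≤ w n i ^ 2 * (4 * B * |t| ^ 3 * δ n) := by
          rw [abs_mul, mul_pow, pow_succ |w n i|, sq_abs]
          calc 4 * B * (w n i ^ 2 * |w n i| * |t| ^ 3)
              = w n i ^ 2 * (4 * B * |t| ^ 3 * |w n i|) := by ring
            _ ≤ _ := by gcongr; exact hwδ i
        have f2 : ((w n i * t) ^ 2 * v / 2) ^ 2 ≤ w n i ^ 2 * (t ^ 4 * v ^ 2 / 4 * δ n ^ 2) := by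
          calc ((w n i * t) ^ 2 * v / 2) ^ 2
              = w n i ^ 2 * (t ^ 4 * v ^ 2 / 4 * |w n i| ^ 2) := by rw [sq_abs]; ring
            _ ≤ _ := by gcongr; exact hwδ i
        linarith
      refine (Finset.sum_le_sum fun i _ => hterm i).trans_eq ?_
      rw [← Finset.sum_mul, hw]
      ring

/-! ### Third moments from sub-Gaussian tails -/

/-- An upper bound for the third absolute moment of a random variable with tails
`P(|Y| > t) ≤ 2 exp(-c t²)`. -/
noncomputable def subGaussianThirdMoment (c : ℝ) : ENNReal :=
  ENNReal.ofReal 3 * ∫⁻ t in Set.Ioi (0 : ℝ),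
    ENNReal.ofReal (2 * Real.exp (-c * t ^ 2)) * ENNReal.ofReal (t ^ (3 - 1 : ℝ))

theorem subGaussianThirdMoment_lt_top {c : ℝ} (hc : 0 < c) : subGaussianThirdMoment c < ⊤ := by
  refine ENNReal.mul_lt_top ENNReal.ofReal_lt_top ?_
  have h := (integrableOn_rpow_mul_exp_neg_mul_sq hc (s := (3 - 1 : ℝ))
    (by norm_num)).const_mul 2
  refine lt_of_eq_of_lt (lintegral_congr fun t => ?_) h.lintegral_lt_top
  rw [← ENNReal.ofReal_mul (by positivity)]
  congr 1
  ring

/-- Layer cake formula: E|Y|³ is the integral of 3t² P(|Y| > t). Working in `ENNReal` yields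
integrability and the moment bound together. -/
theorem lintegral_abs_pow_three_le_of_tail {Ω : Type*} [MeasurableSpace Ω] {μ : Measure Ω}
    [IsProbabilityMeasure μ] {Y : Ω → ℝ} (hY : Measurable Y) {c : ℝ}
    (htail : ∀ t, 0 < t → μ.real {ω | t < |Y ω|} ≤ 2 * Real.exp (-c * t ^ 2)) :
    ∫⁻ ω, ENNReal.ofReal (|Y ω| ^ 3) ∂μ ≤ subGaussianThirdMoment c := by
  have h := lintegral_rpow_eq_lintegral_meas_lt_mul μ (f := fun ω => |Y ω|)
    (ae_of_all _ fun ω => abs_nonneg _) (by fun_prop) (p := 3) (by norm_num)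
  have e : ∀ ω, |Y ω| ^ (3 : ℝ) = |Y ω| ^ 3 := fun ω => by
    rw [← Real.rpow_natCast]; norm_num
  simp_rw [e] at h
  rw [h, subGaussianThirdMoment]
  refine mul_le_mul_right ?_ _
  refine setLIntegral_mono_ae' measurableSet_Ioi (ae_of_all _ fun t (ht : 0 < t) => ?_)
  gcongr
  rw [← ofReal_measureReal]
  exact ENNReal.ofReal_le_ofReal (htail t ht)

theorem integrable_abs_pow_three_of_tail {Ω : Type*} [MeasurableSpace Ω] {μ : Measure Ω}
    [IsProbabilityMeasure μ] {Y : Ω → ℝ} (hY : Measurable Y) {c : ℝ} (hc : 0 < c)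
    (htail : ∀ t, 0 < t → μ.real {ω | t < |Y ω|} ≤ 2 * Real.exp (-c * t ^ 2)) :
    Integrable (fun ω => |Y ω| ^ 3) μ := by
  refine ⟨by fun_prop, ?_⟩
  rw [hasFiniteIntegral_iff_ofReal (ae_of_all _ fun ω => by positivity)]
  exact (lintegral_abs_pow_three_le_of_tail hY htail).trans_lt (subGaussianThirdMoment_lt_top hc)

theorem integral_abs_pow_three_le_of_tail {Ω : Type*} [MeasurableSpace Ω] {μ : Measure Ω}
    [IsProbabilityMeasure μ] {Y : Ω → ℝ} (hY : Measurable Y) {c : ℝ} (hc : 0 < c)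
    (htail : ∀ t, 0 < t → μ.real {ω | t < |Y ω|} ≤ 2 * Real.exp (-c * t ^ 2)) :
    ∫ ω, |Y ω| ^ 3 ∂μ ≤ (subGaussianThirdMoment c).toReal := by
  rw [integral_eq_lintegral_of_nonneg_ae (ae_of_all _ fun ω => by positivity) (by fun_prop)]
  exact ENNReal.toReal_mono (subGaussianThirdMoment_lt_top hc).ne
    (lintegral_abs_pow_three_le_of_tail hY htail)

/-! ### Eigenvalue bounds for symmetric matrices -/

/-- Rayleigh quotient bound: a lower bound for the eigenvalues bounds the quadratic form. -/
theorem Matrix.IsHermitian.mul_dotProduct_self_le {ι : Type*} [Fintype ι] [DecidableEq ι]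
    {A : Matrix ι ι ℝ} (hA : A.IsHermitian) {r : ℝ} (h : ∀ j, r ≤ hA.eigenvalues j) (b : ι → ℝ) :
    r * (b ⬝ᵥ b) ≤ b ⬝ᵥ (A *ᵥ b) := by
  have hT : Aᵀ = A := by
    rw [← Matrix.conjTranspose_eq_transpose_of_trivial]; exact hA
  have hin : ∀ x y : ι → ℝ,
      inner ℝ (WithLp.toLp 2 x : EuclideanSpace ℝ ι) (WithLp.toLp 2 y) = x ⬝ᵥ y := fun x y => by
    rw [EuclideanSpace.inner_toLp_toLp, dotProduct_comm]; simp
  have key : ∀ j, inner ℝ (hA.eigenvectorBasis j) (WithLp.toLp 2 (A *ᵥ b)) =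
      hA.eigenvalues j * inner ℝ (hA.eigenvectorBasis j) (WithLp.toLp 2 b) := fun j => by
    have e1 := hin (hA.eigenvectorBasis j).ofLp (A *ᵥ b)
    have e2 := hin (hA.eigenvectorBasis j).ofLp b
    rw [WithLp.toLp_ofLp] at e1 e2
    rw [e1, e2, Matrix.dotProduct_mulVec, ← Matrix.mulVec_transpose, hT,
      hA.mulVec_eigenvectorBasis, smul_dotProduct, smul_eq_mul]
  -- Parseval in the eigenbasis turns the claim into a termwise comparison.
  rw [← hin, ← hin, ← hA.eigenvectorBasis.sum_inner_mul_inner,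
    ← hA.eigenvectorBasis.sum_inner_mul_inner, Finset.mul_sum]
  refine Finset.sum_le_sum fun j _ => ?_
  rw [key, real_inner_comm]
  nlinarith [h j, mul_self_nonneg
    (inner ℝ (hA.eigenvectorBasis j) (WithLp.toLp 2 b : EuclideanSpace ℝ ι))]

/-- If all eigenvalues of `A` are at least `r`, then `A` expands the norm by at least `r`. -/
theorem Matrix.IsHermitian.mul_norm_le {ι : Type*} [Fintype ι] [DecidableEq ι]
    {A : Matrix ι ι ℝ} (hA : A.IsHermitian) {r : ℝ} (h : ∀ j, r ≤ hA.eigenvalues j) (b : ι → ℝ) :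
    r * ‖(WithLp.toLp 2 b : EuclideanSpace ℝ ι)‖ ≤
      ‖(WithLp.toLp 2 (A *ᵥ b) : EuclideanSpace ℝ ι)‖ := by
  have h1 := hA.mul_dotProduct_self_le h b
  have h2 := real_inner_le_norm (WithLp.toLp 2 b : EuclideanSpace ℝ ι) (WithLp.toLp 2 (A *ᵥ b))
  have h3 : b ⬝ᵥ b = ‖(WithLp.toLp 2 b : EuclideanSpace ℝ ι)‖ ^ 2 := by
    rw [EuclideanSpace.real_norm_sq_eq, dotProduct]
    exact Finset.sum_congr rfl fun i _ => (sq _).symm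
  rw [EuclideanSpace.inner_toLp_toLp, dotProduct_comm, star_trivial] at h2
  rw [h3] at h1
  -- Cauchy-Schwarz gives r‖b‖² ≤ ‖b‖‖Ab‖; cancelling ‖b‖ requires b ≠ 0.
  rcases (norm_nonneg (WithLp.toLp 2 b : EuclideanSpace ℝ ι)).eq_or_lt with h0 | h0
  · rw [← h0, mul_zero]; exact norm_nonneg _
  · nlinarith

/-! ### Algebra of the design and the oracle estimator -/

namespace SaSa.Design

variable {n : ℕ} (D : Design n)

theorem U_inl (o : D.Obs) (l : Fin D.q) : D.U o (Sum.inl l) = D.z o.1 o.2 l := rfl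

theorem U_inr (o : D.Obs) (j : Fin D.K × Fin D.p) :
    D.U o (Sum.inr j) = if D.group o.1 = j.1 then D.x o.1 o.2 j.2 else 0 := by
  simp only [U, X, W, Wtilde, Matrix.fromCols_apply_inr, Matrix.mul_apply, Matrix.of_apply,
    Matrix.kroneckerMap_apply, Matrix.one_apply, Fintype.sum_prod_type]
  rw [Finset.sum_eq_single o.1 (fun i _ hi => by simp [hi.symm]) (by simp)]
  simp

theorem block_beta (α : EuclideanSpace ℝ (Fin D.K × Fin D.p)) (i : Fin n) (l : Fin D.p) :
    D.block (D.beta α) i l = α (D.group i, l) := by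
  simp [block, beta, W, Wtilde, Matrix.mulVec, dotProduct, Matrix.one_apply, Fintype.sum_prod_type]

theorem U_mulVec (θ : D.Idx → ℝ) (o : D.Obs) :
    (D.U *ᵥ θ) o = (∑ l, D.z o.1 o.2 l * θ (Sum.inl l)) +
      ∑ l, D.x o.1 o.2 l * θ (Sum.inr (D.group o.1, l)) := by
  simp only [Matrix.mulVec, dotProduct, Fintype.sum_sum_type, U_inl, U_inr,
    Fintype.sum_prod_type]
  congr 1
  rw [Finset.sum_comm]
  simp

theorem response_eq (η : EuclideanSpace ℝ (Fin D.q)) (α : EuclideanSpace ℝ (Fin D.K × Fin D.p))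
    (e : D.Obs → ℝ) : D.response η (D.beta α) e = D.U *ᵥ (D.stack η α).ofLp + e := by
  ext o
  simp [response, U_mulVec, block_beta, stack]

theorem gram_transpose : D.gramᵀ = D.gram := by
  rw [← Matrix.conjTranspose_eq_transpose_of_trivial]; exact D.gram_isHermitian

/-- The estimation error of the oracle estimator is `(Uᵀ Ω U)⁻¹ Uᵀ Ω ε`. -/
theorem estimate_sub_stack (h : IsUnit D.gram.det) (η : EuclideanSpace ℝ (Fin D.q))
    (α : EuclideanSpace ℝ (Fin D.K × Fin D.p)) (e : D.Obs → ℝ) :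
    D.estimate η α e - D.stack η α =
      WithLp.toLp 2 (D.gram⁻¹ *ᵥ (D.Uᵀ *ᵥ (D.Omega *ᵥ e))) := by
  rw [estimate, oracle, response_eq, Matrix.mulVec_add, Matrix.mulVec_mulVec]
  have h1 : D.gram⁻¹ * D.Uᵀ * D.Omega * D.U = 1 := by
    rw [Matrix.mul_assoc, Matrix.mul_assoc, ← Matrix.mul_assoc D.Uᵀ]
    exact Matrix.nonsing_inv_mul _ h
  rw [h1, Matrix.one_mulVec, Matrix.mulVec_mulVec, Matrix.mulVec_mulVec, WithLp.toLp_add,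
    WithLp.toLp_ofLp, add_sub_cancel_left, Matrix.mul_assoc]

theorem norm_alphaPart_sub_sq (θ θ' : EuclideanSpace ℝ D.Idx) :
    ‖D.alphaPart θ - D.alphaPart θ'‖ ^ 2 ≤ ‖θ - θ'‖ ^ 2 := by
  rw [EuclideanSpace.real_norm_sq_eq, EuclideanSpace.real_norm_sq_eq, Fintype.sum_sum_type]
  exact le_add_of_nonneg_left (Finset.sum_nonneg fun _ _ => sq_nonneg _)

theorem groupSize_le_Gmax (k : Fin D.K) : D.groupSize k ≤ D.Gmax :=
  le_ciSup (Finite.bddAbove_range _) k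

theorem norm_block_beta_sub_sq (α α' : EuclideanSpace ℝ (Fin D.K × Fin D.p)) (i : Fin n) :
    ‖D.block (D.beta α) i - D.block (D.beta α') i‖ ^ 2 =
      ∑ l, (α - α') (D.group i, l) ^ 2 := by
  rw [EuclideanSpace.real_norm_sq_eq]
  simp [block_beta]

theorem norm_block_beta_sub_le (α α' : EuclideanSpace ℝ (Fin D.K × Fin D.p)) (i : Fin n) :
    ‖D.block (D.beta α) i - D.block (D.beta α') i‖ ≤ ‖α - α'‖ := by
  refine le_of_sq_le_sq ?_ (norm_nonneg _)
  rw [norm_block_beta_sub_sq, EuclideanSpace.real_norm_sq_eq, Fintype.sum_prod_type]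
  exact Finset.single_le_sum (f := fun k => ∑ l, (α - α') (k, l) ^ 2)
    (fun k _ => Finset.sum_nonneg fun _ _ => sq_nonneg _) (Finset.mem_univ (D.group i))

/-- The coefficients of group k are repeated once per member, so each squared block is counted at
most |G_max| times. -/
theorem norm_beta_sub_le (α α' : EuclideanSpace ℝ (Fin D.K × Fin D.p)) :
    ‖D.beta α - D.beta α'‖ ≤ √(D.Gmax : ℝ) * ‖α - α'‖ := by
  refine le_of_sq_le_sq ?_ (by positivity)
  rw [mul_pow, Real.sq_sqrt (by positivity), EuclideanSpace.real_norm_sq_eq,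
    EuclideanSpace.real_norm_sq_eq, Fintype.sum_prod_type, Fintype.sum_prod_type, Finset.mul_sum]
  have h1 : ∀ i, ∑ l, (D.beta α - D.beta α') (i, l) ^ 2 = ∑ l, (α - α') (D.group i, l) ^ 2 :=
    fun i => Finset.sum_congr rfl fun l _ => by
      have a1 := D.block_beta α i l
      have a2 := D.block_beta α' i l
      simp only [block] at a1 a2
      simp [a1, a2]
  simp_rw [h1]
  rw [← Finset.sum_fiberwise Finset.univ D.group]
  refine Finset.sum_le_sum fun k _ => ?_
  rw [Finset.sum_congr rfl (g := fun _ => ∑ l, (α - α') (k, l) ^ 2)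
    fun i hi => by rw [(Finset.mem_filter.1 hi).2], Finset.sum_const, nsmul_eq_mul]
  refine mul_le_mul_of_nonneg_right ?_ (Finset.sum_nonneg fun _ _ => sq_nonneg _)
  exact_mod_cast D.groupSize_le_Gmax k

variable {D}

theorem Gmin_pos (hn : 0 < n) : 0 < D.Gmin := by
  have : Nonempty (Fin D.K) := ⟨D.group ⟨0, hn⟩⟩
  obtain ⟨k, hk⟩ := exists_eq_ciInf_of_finite (f := D.groupSize)
  rw [Gmin, ← hk, groupSize, Finset.card_pos]
  obtain ⟨i, hi⟩ := D.group_surj k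
  exact ⟨i, by simp [hi]⟩

theorem minReps_pos (hn : 0 < n) : 0 < D.minReps := by
  have : Nonempty (Fin n) := ⟨⟨0, hn⟩⟩
  obtain ⟨k, hk⟩ := exists_eq_ciInf_of_finite (f := D.reps)
  rw [minReps, ← hk]
  exact D.reps_pos k

theorem minReps_le (i : Fin n) : D.minReps ≤ D.reps i := ciInf_le' _ i

theorem le_maxReps (i : Fin n) : D.reps i ≤ D.maxReps := le_ciSup (Finite.bddAbove_range _) i

theorem K_pos (hn : 0 < n) : 0 < D.K := (Nat.zero_le _).trans_lt (D.group ⟨0, hn⟩).2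

/-! ### Bounds on the design matrix and the score columns -/

variable {M₁ M₂ M₃ C₁ C₁' C₂ C₃ : ℝ}

theorem DesignBounds.isUnit_det (h : D.DesignBounds M₁ M₂ M₃ C₁ C₁' C₂ C₃) (hn : 0 < n)
    (hC₁ : 0 < C₁) : IsUnit D.gram.det := by
  have hG : (0 : ℝ) < D.Gmin := by exact_mod_cast Gmin_pos hn
  have hpd : D.gram.PosDef := D.gram_isHermitian.posDef_iff_eigenvalues_pos.2 fun j =>
    (mul_pos hC₁ hG).trans_le (h.le_eigenvalues j)
  exact hpd.det_pos.ne'.isUnit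

theorem DesignBounds.abs_U_le (h : D.DesignBounds M₁ M₂ M₃ C₁ C₁' C₂ C₃) (hM₁ : 0 < M₁)
    (o : D.Obs) (j : D.Idx) : |D.U o j| ≤ M₁ := by
  rcases j with l | j
  · rw [U_inl]; exact h.abs_z_le _ _ _
  · rw [U_inr]
    split_ifs
    · exact h.abs_x_le _ _ _
    · simpa using hM₁.le

/-- The `j`-th column of `Ω U`. -/
noncomputable def weightedCol (D : Design n) (j : D.Idx) : EuclideanSpace ℝ D.Obs :=
  WithLp.toLp 2 fun o => 1 / (D.reps o.1 : ℝ) * D.U o j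

theorem transpose_U_mulVec_Omega (e : D.Obs → ℝ) (j : D.Idx) :
    (D.Uᵀ *ᵥ (D.Omega *ᵥ e)) j = ∑ o, D.weightedCol j o * e o := by
  simp only [Omega, Matrix.mulVec, dotProduct, Matrix.transpose_apply, weightedCol,
    Matrix.diagonal_apply, ite_mul, zero_mul, Finset.sum_ite_eq, Finset.mem_univ, if_true]
  exact Finset.sum_congr rfl fun o _ => by ring

/-- Location i contributes n_i squares of size at most M₁²/n_i², in total M₁²/n_i, and there are n
locations. -/
theorem DesignBounds.norm_weightedCol_le (h : D.DesignBounds M₁ M₂ M₃ C₁ C₁' C₂ C₃) (hM₁ : 0 < M₁)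
    (hn : 0 < n) (j : D.Idx) : ‖D.weightedCol j‖ ≤ M₁ * √((n : ℝ) / D.minReps) := by
  have hm : (0 : ℝ) < D.minReps := by exact_mod_cast minReps_pos hn
  refine le_of_sq_le_sq ?_ (by positivity)
  rw [mul_pow, Real.sq_sqrt (by positivity), EuclideanSpace.real_norm_sq_eq, Fintype.sum_sigma]
  calc ∑ i, ∑ k, D.weightedCol j ⟨i, k⟩ ^ 2 ≤ ∑ i : Fin n, ∑ k : Fin (D.reps i),
        (1 / (D.reps i : ℝ)) ^ 2 * M₁ ^ 2 := by
        refine Finset.sum_le_sum fun i _ => Finset.sum_le_sum fun k _ => ?_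
        simp only [weightedCol, mul_pow]
        gcongr ?_ * ?_
        exact sq_le_sq' (neg_le_of_abs_le (h.abs_U_le hM₁ _ _)) (le_of_abs_le (h.abs_U_le hM₁ _ _))
    _ = ∑ i : Fin n, M₁ ^ 2 * (1 / (D.reps i : ℝ)) := by
        refine Finset.sum_congr rfl fun i _ => ?_
        have : (D.reps i : ℝ) ≠ 0 := by exact_mod_cast (D.reps_pos i).ne'
        simp only [Finset.sum_const, Finset.card_univ, Fintype.card_fin, nsmul_eq_mul]
        field_simp
    _ ≤ ∑ i : Fin n, M₁ ^ 2 * (1 / (D.minReps : ℝ)) := by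
        gcongr with i
        exact_mod_cast minReps_le i
    _ = _ := by simp; ring

/-! ### Linear functionals of the error and the Lindeberg ratio -/

/-- `v = Ω U (Uᵀ Ω U)⁻¹ a`, the vector with `aᵀ (θ̂ - θ) = vᵀ ε`. -/
noncomputable def functionalWeight (D : Design n) (a : EuclideanSpace ℝ D.Idx) : D.Obs → ℝ :=
  D.Omega *ᵥ (D.U *ᵥ (D.gram⁻¹ *ᵥ a.ofLp))

theorem Omega_transpose : D.Omegaᵀ = D.Omega := by simp [Omega]

theorem inner_estimate_sub_stack (h : IsUnit D.gram.det) (η : EuclideanSpace ℝ (Fin D.q))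
    (α : EuclideanSpace ℝ (Fin D.K × Fin D.p)) (e : D.Obs → ℝ) (a : EuclideanSpace ℝ D.Idx) :
    inner ℝ a (D.estimate η α e - D.stack η α) = ∑ o, D.functionalWeight a o * e o := by
  have h0 : inner ℝ a (D.estimate η α e - D.stack η α) =
      a.ofLp ⬝ᵥ (D.gram⁻¹ *ᵥ (D.Uᵀ *ᵥ (D.Omega *ᵥ e))) := by
    rw [D.estimate_sub_stack h, EuclideanSpace.inner_eq_star_dotProduct, dotProduct_comm]
    simp
  change _ = D.functionalWeight a ⬝ᵥ e
  rw [h0, Matrix.dotProduct_mulVec, Matrix.dotProduct_mulVec, Matrix.dotProduct_mulVec,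
    ← Matrix.mulVec_transpose, ← Matrix.mulVec_transpose, ← Matrix.mulVec_transpose,
    Matrix.transpose_nonsing_inv, gram_transpose, Omega_transpose, Matrix.transpose_transpose,
    functionalWeight]

/-- By symmetry of G and Ω, the sandwich form is vᵀv. -/
theorem sigmaN_eq (σ : ℝ) (a : EuclideanSpace ℝ D.Idx) :
    D.sigmaN σ a = σ * √(∑ o, D.functionalWeight a o ^ 2) := by
  have h : a.ofLp ⬝ᵥ ((D.gram⁻¹ * (D.Uᵀ * D.Omega * D.Omega * D.U) * D.gram⁻¹) *ᵥ a.ofLp) =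
      D.functionalWeight a ⬝ᵥ D.functionalWeight a := by
    rw [Matrix.mul_assoc, ← Matrix.mulVec_mulVec, Matrix.dotProduct_mulVec,
      ← Matrix.mulVec_transpose, Matrix.transpose_nonsing_inv, gram_transpose,
      ← Matrix.mulVec_mulVec, Matrix.mul_assoc, Matrix.mul_assoc, ← Matrix.mulVec_mulVec,
      Matrix.dotProduct_mulVec, Matrix.vecMul_transpose, ← Matrix.mulVec_mulVec,
      Matrix.dotProduct_mulVec, ← Matrix.mulVec_transpose, Omega_transpose,
      ← Matrix.mulVec_mulVec]
    rfl
  rw [sigmaN, h, dotProduct]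
  simp_rw [sq]

theorem functionalWeight_apply (a : EuclideanSpace ℝ D.Idx) (o : D.Obs) :
    D.functionalWeight a o = 1 / (D.reps o.1 : ℝ) * (D.U *ᵥ (D.gram⁻¹ *ᵥ a.ofLp)) o := by
  simp [functionalWeight, Omega, Matrix.mulVec_diagonal]

theorem dotProduct_gram_mulVec (b : D.Idx → ℝ) :
    b ⬝ᵥ (D.gram *ᵥ b) = ∑ o, 1 / (D.reps o.1 : ℝ) * (D.U *ᵥ b) o ^ 2 := by
  rw [gram, ← Matrix.mulVec_mulVec, ← Matrix.mulVec_mulVec, Matrix.dotProduct_mulVec b,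
    Matrix.vecMul_transpose]
  simp only [Omega, Matrix.mulVec_diagonal, dotProduct]
  exact Finset.sum_congr rfl fun o _ => by ring

/-- Rows of `U` have squared norm at most `(C₂² + C₃²) (q + K p)`. -/
theorem DesignBounds.sq_U_mulVec_le (h : D.DesignBounds M₁ M₂ M₃ C₁ C₁' C₂ C₃) (hn : 0 < n)
    (b : D.Idx → ℝ) (o : D.Obs) :
    (D.U *ᵥ b) o ^ 2 ≤ (C₂ ^ 2 + C₃ ^ 2) * ((D.q : ℝ) + D.K * D.p) * (b ⬝ᵥ b) := by
  have hcs : (D.U *ᵥ b) o ^ 2 ≤ (∑ j, D.U o j ^ 2) * ∑ j, b j ^ 2 :=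
    Finset.sum_mul_sq_le_sq_mul_sq _ _ _
  have hb : b ⬝ᵥ b = ∑ j, b j ^ 2 := Finset.sum_congr rfl fun j _ => (sq _).symm
  rw [hb]
  refine hcs.trans (mul_le_mul_of_nonneg_right ?_ (Finset.sum_nonneg fun _ _ => sq_nonneg _))
  -- In a row of U the vector x fills only the block of its own group, so no factor K appears.
  have hU : ∑ j, D.U o j ^ 2 = ‖D.z o.1 o.2‖ ^ 2 + ‖D.x o.1 o.2‖ ^ 2 := by
    rw [Fintype.sum_sum_type, Fintype.sum_prod_type, Finset.sum_comm,
      EuclideanSpace.real_norm_sq_eq, EuclideanSpace.real_norm_sq_eq]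
    simp [U_inl, U_inr, ite_pow]
  have hz := pow_le_pow_left₀ (norm_nonneg _) (h.norm_z_le o.1 o.2) 2
  have hx := pow_le_pow_left₀ (norm_nonneg _) (h.norm_x_le o.1 o.2) 2
  rw [mul_pow, Real.sq_sqrt (Nat.cast_nonneg _)] at hz hx
  rw [hU]
  have hK : (1 : ℝ) ≤ D.K := by exact_mod_cast K_pos hn
  have hp : (D.p : ℝ) ≤ D.K * D.p := le_mul_of_one_le_left (Nat.cast_nonneg _) hK
  have hq : (0 : ℝ) ≤ D.q := Nat.cast_nonneg _
  have hp0 : (0 : ℝ) ≤ D.p := Nat.cast_nonneg _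
  nlinarith [mul_nonneg (sq_nonneg C₂) hq, mul_nonneg (sq_nonneg C₃) (hp0.trans hp),
    mul_le_mul_of_nonneg_left hp (sq_nonneg C₂)]

/-- Each term (Ub)_o²/n_i of bᵀGb equals n_i v_o², hence is at most max n_i times v_o². Together the
two parts give v ≠ 0, so σ_n(a) can be divided by. -/
theorem DesignBounds.sum_functionalWeight_sq_pos (h : D.DesignBounds M₁ M₂ M₃ C₁ C₁' C₂ C₃)
    (hn : 0 < n) (hC₁ : 0 < C₁) {a : EuclideanSpace ℝ D.Idx} (ha : a ≠ 0) :
    0 < (D.gram⁻¹ *ᵥ a.ofLp) ⬝ᵥ (D.gram⁻¹ *ᵥ a.ofLp) ∧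
    C₁ * D.Gmin / D.maxReps * ((D.gram⁻¹ *ᵥ a.ofLp) ⬝ᵥ (D.gram⁻¹ *ᵥ a.ofLp)) ≤
      ∑ o, D.functionalWeight a o ^ 2 := by
  set b := D.gram⁻¹ *ᵥ a.ofLp with hb
  have hb0 : b ≠ 0 := by
    intro h0
    apply ha
    have h1 : D.gram *ᵥ b = a.ofLp := by
      rw [hb, Matrix.mulVec_mulVec, Matrix.mul_nonsing_inv _ (h.isUnit_det hn hC₁),
        Matrix.one_mulVec]
    rw [h0, Matrix.mulVec_zero] at h1
    exact WithLp.ofLp_injective 2 h1.symm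
  have hmax : (0 : ℝ) < D.maxReps := by
    exact_mod_cast (D.reps_pos ⟨0, hn⟩).trans_le (le_maxReps _)
  refine ⟨by simpa using Matrix.dotProduct_star_self_pos_iff.2 hb0, ?_⟩
  have h1 := D.gram_isHermitian.mul_dotProduct_self_le h.le_eigenvalues b
  rw [dotProduct_gram_mulVec] at h1
  rw [div_mul_eq_mul_div, div_le_iff₀ hmax, Finset.sum_mul]
  refine h1.trans (Finset.sum_le_sum fun o _ => ?_)
  rw [functionalWeight_apply]
  have hr : (0 : ℝ) < D.reps o.1 := by exact_mod_cast D.reps_pos o.1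
  have hr' : (D.reps o.1 : ℝ) ≤ D.maxReps := by exact_mod_cast le_maxReps o.1
  have e : 1 / (D.reps o.1 : ℝ) * (D.U *ᵥ b) o ^ 2 =
      (1 / (D.reps o.1 : ℝ) * (D.U *ᵥ b) o) ^ 2 * D.reps o.1 := by field_simp
  rw [e]
  gcongr

/-- No single observation dominates: the Lindeberg ratio of the weights `v`. -/
theorem DesignBounds.functionalWeight_sq_le (h : D.DesignBounds M₁ M₂ M₃ C₁ C₁' C₂ C₃)
    (hn : 0 < n) (hC₁ : 0 < C₁) {a : EuclideanSpace ℝ D.Idx} (ha : a ≠ 0) (o : D.Obs) :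
    D.functionalWeight a o ^ 2 ≤
      M₃ * (C₂ ^ 2 + C₃ ^ 2) / C₁ * (((D.q : ℝ) + D.K * D.p) / D.Gmin) *
        ∑ o, D.functionalWeight a o ^ 2 := by
  obtain ⟨hb, hlow⟩ := h.sum_functionalWeight_sq_pos hn hC₁ ha
  set b := D.gram⁻¹ *ᵥ a.ofLp with hbdef
  set S := ∑ o, D.functionalWeight a o ^ 2
  have hG : (0 : ℝ) < D.Gmin := by exact_mod_cast Gmin_pos hn
  have hm : (1 : ℝ) ≤ D.minReps := by exact_mod_cast minReps_pos hn
  have hm0 : (0 : ℝ) < D.minReps := by linarith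
  have hr : (D.minReps : ℝ) ≤ D.reps o.1 := by exact_mod_cast minReps_le o.1
  have hmax : (0 : ℝ) < D.maxReps := by
    exact_mod_cast (D.reps_pos ⟨0, hn⟩).trans_le (le_maxReps _)
  have hU := h.sq_U_mulVec_le hn b o
  set d : ℝ := (D.q : ℝ) + D.K * D.p
  have hd : 0 ≤ d := by positivity
  have hM := h.ratio_le
  have hbS : b ⬝ᵥ b ≤ D.maxReps / (C₁ * D.Gmin) * S := by
    rw [div_mul_eq_mul_div, le_div_iff₀ (by positivity)]
    rw [div_mul_eq_mul_div, div_le_iff₀ hmax] at hlow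
    linarith
  have hS : 0 ≤ S := Finset.sum_nonneg fun _ _ => sq_nonneg _
  -- One factor 1 / min n_i is kept to pair with max n_i, giving the ratio bounded by M₃; the other
  -- is dropped because min n_i ≥ 1.
  have h1 : (1 / (D.reps o.1 : ℝ)) ^ 2 ≤ 1 / (D.minReps : ℝ) := by
    calc (1 / (D.reps o.1 : ℝ)) ^ 2 ≤ (1 / (D.minReps : ℝ)) ^ 2 := by gcongr
      _ ≤ 1 / (D.minReps : ℝ) := by
        rw [sq]
        exact mul_le_of_le_one_right (by positivity) (by rw [div_le_one hm0]; exact hm)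
  rw [functionalWeight_apply, mul_pow, ← hbdef]
  calc (1 / (D.reps o.1 : ℝ)) ^ 2 * (D.U *ᵥ b) o ^ 2
      ≤ 1 / (D.minReps : ℝ) * ((C₂ ^ 2 + C₃ ^ 2) * d * (D.maxReps / (C₁ * D.Gmin) * S)) := by
        gcongr
        exact hU.trans (by gcongr)
    _ = (D.maxReps / D.minReps) * ((C₂ ^ 2 + C₃ ^ 2) / C₁ * (d / D.Gmin) * S) := by
        field_simp
    _ ≤ M₃ * ((C₂ ^ 2 + C₃ ^ 2) / C₁ * (d / D.Gmin) * S) := by gcongr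
    _ = _ := by ring

/-! ### Concentration of the scores and the error bounds -/

variable {Ω : Type*} [MeasurableSpace Ω] {μ : Measure Ω} {ε : D.Obs → Ω → ℝ} {σ c₁ : ℝ}

/-- The level t = 0 occurs for n = 1, where log n = 0; there the right side is 2. -/
theorem IsSubGaussianNoise.tail_of_nonneg [IsProbabilityMeasure μ]
    (h : D.IsSubGaussianNoise μ ε σ c₁) (a : EuclideanSpace ℝ D.Obs) {t : ℝ} (ht : 0 ≤ t) :
    μ.real {ω | ‖a‖ * t < |∑ o, a o * ε o ω|} ≤ 2 * Real.exp (-c₁ * t ^ 2) := by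
  rcases ht.eq_or_lt with rfl | ht
  · refine measureReal_le_one.trans ?_
    norm_num
  · exact h.tail a t ht

theorem IsSubGaussianNoise.tail_apply (h : D.IsSubGaussianNoise μ ε σ c₁) (o : D.Obs) {t : ℝ}
    (ht : 0 < t) : μ.real {ω | t < |ε o ω|} ≤ 2 * Real.exp (-c₁ * t ^ 2) := by
  have := h.tail (EuclideanSpace.single o 1) t ht
  simpa using this

/-- The deterministic part of the error bound: uniform control of the scores `(Ω U_j)ᵀ ε`
bounds the estimation error. -/
theorem DesignBounds.norm_estimate_sub_stack_le (h : D.DesignBounds M₁ M₂ M₃ C₁ C₁' C₂ C₃)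
    (hn : 0 < n) (hM₁ : 0 < M₁) (hC₁ : 0 < C₁) (hc₁ : 0 < c₁) (η : EuclideanSpace ℝ (Fin D.q))
    (α : EuclideanSpace ℝ (Fin D.K × Fin D.p)) (e : D.Obs → ℝ)
    (he : ∀ j, |∑ o, D.weightedCol j o * e o| ≤ ‖D.weightedCol j‖ * √(Real.log n / c₁)) :
    ‖D.estimate η α e - D.stack η α‖ ≤ D.phi M₁ C₁ c₁ := by
  have hG : (0 : ℝ) < D.Gmin := by exact_mod_cast Gmin_pos hn
  set t := √(Real.log n / c₁) with ht
  set d : ℝ := (D.q : ℝ) + D.K * D.p with hd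
  set g : D.Idx → ℝ := D.Uᵀ *ᵥ (D.Omega *ᵥ e) with hg
  set r := M₁ * √((n : ℝ) / D.minReps) * t with hr
  have hr0 : 0 ≤ r := by positivity
  have hgn : ‖(WithLp.toLp 2 g : EuclideanSpace ℝ D.Idx)‖ ≤ √d * r := by
    refine le_of_sq_le_sq ?_ (by positivity)
    rw [mul_pow, Real.sq_sqrt (by positivity), EuclideanSpace.real_norm_sq_eq]
    have h1 : ∀ j ∈ Finset.univ, g j ^ 2 ≤ r ^ 2 := fun j _ => by
      rw [← sq_abs]
      refine pow_le_pow_left₀ (abs_nonneg _) ?_ 2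
      rw [hg, transpose_U_mulVec_Omega]
      exact (he j).trans (mul_le_mul_of_nonneg_right (h.norm_weightedCol_le hM₁ hn j)
        (Real.sqrt_nonneg _))
    refine (Finset.sum_le_card_nsmul _ _ _ h1).trans_eq ?_
    simp [hd]
  have hinv := D.gram_isHermitian.mul_norm_le h.le_eigenvalues (D.gram⁻¹ *ᵥ g)
  rw [Matrix.mulVec_mulVec g, Matrix.mul_nonsing_inv _ (h.isUnit_det hn hC₁),
    Matrix.one_mulVec] at hinv
  rw [D.estimate_sub_stack (h.isUnit_det hn hC₁)]
  have h2 : D.phi M₁ C₁ c₁ = √d * r / (C₁ * D.Gmin) := by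
    rw [phi, hr, ht, Real.sqrt_mul (by positivity), Real.sqrt_div' _ hc₁.le]
    field_simp
    rw [hd]
    ring
  rw [h2, le_div_iff₀ (by positivity), mul_comm]
  exact hinv.trans hgn

/-- One event `E`, on which all scores are controlled, implies the three bounds at once; a union
bound over the q + Kp columns controls its complement. -/
theorem DesignBounds.le_measureReal_error_bounds [IsProbabilityMeasure μ]
    (h : D.DesignBounds M₁ M₂ M₃ C₁ C₁' C₂ C₃)
    (hε : D.IsSubGaussianNoise μ ε σ c₁) (hn : 0 < n) (hM₁ : 0 < M₁) (hC₁ : 0 < C₁)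
    (hc₁ : 0 < c₁) (η : EuclideanSpace ℝ (Fin D.q)) (α : EuclideanSpace ℝ (Fin D.K × Fin D.p)) :
    1 - 2 * (D.q + D.K * D.p : ℝ) / n ≤ μ.real {ω |
      ‖D.estimate η α (fun o => ε o ω) - D.stack η α‖ ≤ D.phi M₁ C₁ c₁ ∧
      ‖D.beta (D.alphaPart (D.estimate η α fun o => ε o ω)) - D.beta α‖ ≤
        √(D.Gmax : ℝ) * D.phi M₁ C₁ c₁ ∧
      ∀ i, ‖D.block (D.beta (D.alphaPart (D.estimate η α fun o => ε o ω))) i -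
        D.block (D.beta α) i‖ ≤ D.phi M₁ C₁ c₁} := by
  set t := √(Real.log n / c₁) with ht
  let E : Set Ω := {ω | ∀ j, |∑ o, D.weightedCol j o * ε o ω| ≤ ‖D.weightedCol j‖ * t}
  have hn1 : (1 : ℝ) ≤ n := by exact_mod_cast hn
  have hE : μ.real Eᶜ ≤ 2 * (D.q + D.K * D.p : ℝ) / n := by
    have hsub : Eᶜ = ⋃ j, {ω | ‖D.weightedCol j‖ * t < |∑ o, D.weightedCol j o * ε o ω|} := by
      ext ω
      simp only [E, Set.mem_compl_iff, Set.mem_ofPred_eq, Set.mem_iUnion, not_forall, not_le]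
    -- The level t is chosen so that each column fails with probability at most 2/n.
    have hexp : Real.exp (-c₁ * t ^ 2) = (n : ℝ)⁻¹ := by
      rw [ht, Real.sq_sqrt (div_nonneg (Real.log_nonneg hn1) hc₁.le), neg_mul,
        mul_div_cancel₀ _ hc₁.ne', Real.exp_neg, Real.exp_log (by linarith)]
    rw [hsub]
    refine (measureReal_iUnion_fintype_le _).trans ?_
    refine (Finset.sum_le_card_nsmul _ _ (2 * (n : ℝ)⁻¹) fun j _ => ?_).trans_eq ?_
    · rw [← hexp]
      exact hε.tail_of_nonneg _ (Real.sqrt_nonneg _)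
    · simp
      ring
  -- Subadditivity suffices, so measurability of `E` is not needed.
  have hone : 1 ≤ μ.real E + μ.real Eᶜ := by
    have := measureReal_union_le (μ := μ) E Eᶜ
    rwa [Set.union_compl_self, probReal_univ] at this
  have hmono : E ⊆ {ω |
      ‖D.estimate η α (fun o => ε o ω) - D.stack η α‖ ≤ D.phi M₁ C₁ c₁ ∧
      ‖D.beta (D.alphaPart (D.estimate η α fun o => ε o ω)) - D.beta α‖ ≤
        √(D.Gmax : ℝ) * D.phi M₁ C₁ c₁ ∧
      ∀ i, ‖D.block (D.beta (D.alphaPart (D.estimate η α fun o => ε o ω))) i -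
        D.block (D.beta α) i‖ ≤ D.phi M₁ C₁ c₁} := by
    intro ω hω
    have h1 := h.norm_estimate_sub_stack_le hn hM₁ hC₁ hc₁ η α (fun o => ε o ω) hω
    have h2 : ‖D.alphaPart (D.estimate η α fun o => ε o ω) - α‖ ≤ D.phi M₁ C₁ c₁ := by
      refine le_trans ?_ h1
      -- `α` is definitionally the `alphaPart` of `stack η α`.
      exact le_of_sq_le_sq (D.norm_alphaPart_sub_sq _ (D.stack η α)) (norm_nonneg _)
    exact ⟨h1, (D.norm_beta_sub_le _ _).trans (by gcongr),
      fun i => (D.norm_block_beta_sub_le _ _ i).trans h2⟩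
  have := measureReal_mono (μ := μ) hmono
  linarith

theorem IsSubGaussianNoise.integral_sq [IsProbabilityMeasure μ]
    (h : D.IsSubGaussianNoise μ ε σ c₁) (hε : ∀ o, Measurable (ε o)) (o : D.Obs) :
    ∫ ω, ε o ω ^ 2 ∂μ = σ ^ 2 := by
  rw [← h.variance o, variance_of_integral_eq_zero (hε o).aemeasurable (h.mean o)]

end SaSa.Design

/-! ### The main theorem -/

theorem theorem1
    (D : (n : ℕ) → SaSa.Design n)
    (η₀ : (n : ℕ) → EuclideanSpace ℝ (Fin (D n).q))
    (α₀ : (n : ℕ) → EuclideanSpace ℝ (Fin (D n).K × Fin (D n).p))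
    {Ω : ℕ → Type*} [∀ n, MeasurableSpace (Ω n)]
    (μ : (n : ℕ) → Measure (Ω n)) [∀ n, IsProbabilityMeasure (μ n)]
    (ε : (n : ℕ) → (D n).Obs → Ω n → ℝ)
    (hε : ∀ n o, Measurable (ε n o))
    (M₁ M₂ M₃ C₁ C₁' C₂ C₃ c₁ σ : ℝ)
    (hM₁ : 0 < M₁) (hM₂ : 0 < M₂) (hM₃ : 0 < M₃) (hC₁ : 0 < C₁) (hC₁' : 0 < C₁')
    (hC₂ : 0 < C₂) (hC₃ : 0 < C₃) (hc₁ : 0 < c₁) (hσ : 0 < σ)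
    (N : ℕ) (hN : 1 ≤ N)
    (hdesign : ∀ n, N ≤ n → (D n).DesignBounds M₁ M₂ M₃ C₁ C₁' C₂ C₃)
    (hnoise : ∀ n, N ≤ n → (D n).IsSubGaussianNoise (μ n) (ε n) σ c₁)
    (hq : Tendsto (fun n : ℕ => ((D n).q : ℝ) / n) atTop (𝓝 0))
    (hKp : Tendsto (fun n : ℕ => ((D n).K * (D n).p : ℝ) / n) atTop (𝓝 0))
    (hG : Tendsto (fun n : ℕ =>
      √((D n).q + (D n).K * (D n).p : ℝ) *
        max √((n : ℝ) / (D n).minReps * Real.log n) √((D n).q + (D n).K * (D n).p : ℝ) /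
          (D n).Gmin) atTop (𝓝 0)) :
    (∀ n, N ≤ n →
      1 - 2 * ((D n).q + (D n).K * (D n).p : ℝ) / n ≤
        (μ n).real {ω |
          ‖(D n).estimate (η₀ n) (α₀ n) (fun o => ε n o ω) - (D n).stack (η₀ n) (α₀ n)‖ ≤
            (D n).phi M₁ C₁ c₁ ∧
          ‖(D n).beta ((D n).alphaPart ((D n).estimate (η₀ n) (α₀ n) fun o => ε n o ω)) -
              (D n).beta (α₀ n)‖ ≤ √((D n).Gmax : ℝ) * (D n).phi M₁ C₁ c₁ ∧
          ∀ i, ‖(D n).block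
                  ((D n).beta ((D n).alphaPart ((D n).estimate (η₀ n) (α₀ n) fun o => ε n o ω))) i -
                (D n).block ((D n).beta (α₀ n)) i‖ ≤ (D n).phi M₁ C₁ c₁}) ∧
    ∀ a : (n : ℕ) → EuclideanSpace ℝ (D n).Idx, (∀ᶠ n in atTop, a n ≠ 0) →
      TendstoInDistribution
        (fun n ω => ((D n).sigmaN σ (a n))⁻¹ *
          inner ℝ (a n)
            ((D n).estimate (η₀ n) (α₀ n) (fun o => ε n o ω) - (D n).stack (η₀ n) (α₀ n)))
        atTop (id : ℝ → ℝ) μ (gaussianReal 0 1) := by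
  refine ⟨fun n hn => (hdesign n hn).le_measureReal_error_bounds (hnoise n hn) (hN.trans hn) hM₁
    hC₁ hc₁ _ _, fun a ha => ?_⟩
  set ρ : ℕ → ℝ := fun n =>
    M₃ * (C₂ ^ 2 + C₃ ^ 2) / C₁ * ((((D n).q : ℝ) + (D n).K * (D n).p) / (D n).Gmin) with hρ
  have hratio : Tendsto (fun n => (((D n).q : ℝ) + (D n).K * (D n).p) / (D n).Gmin) atTop
      (𝓝 0) := by
    -- The second entry of the maximum turns the rate condition into (q+Kp)/|G_min| → 0.
    refine squeeze_zero (fun n => by positivity) (fun n => ?_) hG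
    gcongr
    calc ((D n).q : ℝ) + (D n).K * (D n).p
        = √((D n).q + (D n).K * (D n).p : ℝ) * √((D n).q + (D n).K * (D n).p : ℝ) :=
          (Real.mul_self_sqrt (by positivity)).symm
      _ ≤ _ := by gcongr; exact le_max_right _ _
  have hδ : Tendsto (fun n => σ⁻¹ * √(ρ n)) atTop (𝓝 0) := by
    have := ((hratio.const_mul (M₃ * (C₂ ^ 2 + C₃ ^ 2) / C₁)).sqrt).const_mul σ⁻¹
    simpa using this
  have hev := (eventually_ge_atTop N).and ha
  have hclt := tendstoInDistribution_sum_of_third_moment_le (μ := μ) (Y := ε)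
    (w := fun n o => ((D n).sigmaN σ (a n))⁻¹ * (D n).functionalWeight (a n) o)
    (v := σ ^ 2) (B := (subGaussianThirdMoment c₁).toReal) (δ := fun n => σ⁻¹ * √(ρ n))
    (by positivity) hε
    (hev.mono fun n hn => (hnoise n hn.1).indep)
    (hev.mono fun n hn o => ((hnoise n hn.1).memLp o).integrable one_le_two)
    (hev.mono fun n hn o => ((hnoise n hn.1).memLp o).integrable_sq)
    (hev.mono fun n hn o => integrable_abs_pow_three_of_tail (hε n o) hc₁
      fun t ht => (hnoise n hn.1).tail_apply o ht)
    (hev.mono fun n hn o => (hnoise n hn.1).mean o)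
    (hev.mono fun n hn o => (hnoise n hn.1).integral_sq (hε n) o)
    (hev.mono fun n hn o => integral_abs_pow_three_le_of_tail (hε n o) hc₁
      fun t ht => (hnoise n hn.1).tail_apply o ht)
    (hev.mono fun n hn => ?_) (hev.mono fun n hn o => ?_) hδ
  · refine ⟨fun n => ?_, aemeasurable_id, ?_⟩
    -- Measurability is required for every n, also where G may be singular, so the estimator is
    -- expanded directly as an affine function of the errors.
    · have h : ∀ e : (D n).Obs → ℝ,
          inner ℝ (a n) ((D n).estimate (η₀ n) (α₀ n) e - (D n).stack (η₀ n) (α₀ n)) =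
            ∑ j, ((∑ o, ((D n).gram⁻¹ * (D n).Uᵀ * (D n).Omega) j o *
              (((D n).U *ᵥ ((D n).stack (η₀ n) (α₀ n)).ofLp) o + e o)) -
                (D n).stack (η₀ n) (α₀ n) j) * a n j := fun e => by
        rw [SaSa.Design.estimate, SaSa.Design.oracle, SaSa.Design.response_eq]
        rfl
      have := hε n
      simp_rw [h]
      fun_prop
    · refine hclt.tendsto.congr' (hev.mono fun n hn => Subtype.ext ?_)
      change (μ n).map _ = (μ n).map _
      congr 1
      funext ω
      rw [SaSa.Design.inner_estimate_sub_stack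
        ((hdesign n hn.1).isUnit_det (hN.trans hn.1) hC₁), Finset.mul_sum]
      exact Finset.sum_congr rfl fun o _ => mul_assoc _ _ _
  all_goals
    have hn0 : 0 < n := hN.trans hn.1
    have hS : 0 < ∑ o, (D n).functionalWeight (a n) o ^ 2 := by
      obtain ⟨hb, hlow⟩ := (hdesign n hn.1).sum_functionalWeight_sq_pos hn0 hC₁ hn.2
      refine lt_of_lt_of_le (mul_pos (div_pos (mul_pos hC₁ ?_) ?_) hb) hlow
      · exact_mod_cast SaSa.Design.Gmin_pos hn0
      · exact_mod_cast ((D n).reps_pos ⟨0, hn0⟩).trans_le (SaSa.Design.le_maxReps _)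
  -- Normalization: the squares of v_o/(σ‖v‖) sum to 1/σ².
  · simp_rw [mul_pow]
    rw [← Finset.mul_sum, SaSa.Design.sigmaN_eq, inv_pow, mul_pow, Real.sq_sqrt hS.le]
    field_simp
  -- The square root of the Lindeberg ratio bounds |v_o|/‖v‖.
  · have hle := (hdesign n hn.1).functionalWeight_sq_le hn0 hC₁ hn.2 o
    rw [SaSa.Design.sigmaN_eq, abs_mul, abs_of_nonneg (by positivity), mul_inv, mul_assoc]
    gcongr
    rw [inv_mul_le_iff₀ (by positivity), mul_comm, ← Real.sqrt_mul' _ hS.le,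
      ← Real.sqrt_sq_eq_abs]
    exact Real.sqrt_le_sqrt hle
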